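/- Let $k\ge 1$ be an integer, let $P_{2k+1}$ be the path with $2k+1$ vertices, and let $H$ be a finite simple graph with at least one vertex. Write $|H|$ for the number of vertices of $H$, and let $\pi(H)$ be the maximum number of edges of a spanning linear forest of $H$, where a forest is called linear if each of its components is a path (a single vertex counts as a path). The lexicographic product $G[H]$ of two graphs $G$ and $H$ is the graph with vertex set $V(G)\times V(H)$ in which $(g,h)$ and $(g',h')$ are adjacent if and only if $gg'\in E(G)$, or $g=g'$ and $hh'\in E(H)$. A graph is hamiltonian connected if every two distinct vertices are joined by a path containing all vertices of the graph. Then the lexicographic product $P_{2k+1}[H]$ is hamiltonian connected if and only if $$\pi(H)\ge 2\quad\text{and}\quad \left\lceil\frac{|H|+1}{\pi(H)}\right\rceil\le k+1.$$ -/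

import Mathlib

namespace SimpleGraph

universe u v

/-- The lexicographic product `G[H]`: vertex set `V(G) × V(H)`, where `(g, h)` and `(g', h')` are
adjacent iff `g g'` is an edge of `G`, or `g = g'` and `h h'` is an edge of `H`. -/
def lexProduct {V : Type u} {W : Type v} (G : SimpleGraph V) (H : SimpleGraph W) :
    SimpleGraph (V × W) where
  Adj x y := G.Adj x.1 y.1 ∨ (x.1 = y.1 ∧ H.Adj x.2 y.2)
  symm := ⟨fun _ _ h => h.imp (fun h => h.symm) (fun h => ⟨h.1.symm, h.2.symm⟩)⟩
  loopless := ⟨fun x h => h.elim (fun h => G.loopless.irrefl x.1 h)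
    (fun h => H.loopless.irrefl x.2 h.2)⟩

/-- A linear forest: a forest each of whose connected components is a path (a single vertex
counts as a path). -/
def IsLinearForest {V : Type u} (F : SimpleGraph V) : Prop :=
  F.IsAcyclic ∧ ∀ c : F.ConnectedComponent, ∃ n : ℕ, Nonempty (c.toSimpleGraph ≃g pathGraph n)

/-- `π(G)`: the maximum number of edges of a spanning linear forest of `G`. A spanning subgraph
of `G` is a graph `F ≤ G` on the same vertex type. For a finite graph the set is nonempty and
bounded, so the supremum is a maximum. -/
noncomputable def maxLinearForest {V : Type u} (G : SimpleGraph V) : ℕ :=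
  sSup {m : ℕ | ∃ F : SimpleGraph V, F ≤ G ∧ F.IsLinearForest ∧ F.edgeSet.ncard = m}

/-- A graph is hamiltonian connected if any two distinct vertices are joined by a
hamiltonian path. -/
def IsHamiltonianConnected {V : Type u} [DecidableEq V] (G : SimpleGraph V) : Prop :=
  ∀ x y : V, x ≠ y → ∃ p : G.Walk x y, p.IsHamiltonian

end SimpleGraph

/-! Write n for |H| and π for π(H); the ceiling condition says n + 1 ≤ (k+1)π. Linear forests enter
only through orderings: π is the largest number of consecutive H-adjacent pairs in an ordering of V
(`pairCount_le_maxLinearForest`, `exists_maxLinearForest_le_pairCount`). Hence a hamiltonian path of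
the product uses at most π edges inside any layer {i} × V.

Necessity. Take a hamiltonian path with both ends in layer 1. Each of the (k+1)n vertices in even
layers is entered either inside its layer, at most (k+1)π times, or from an odd layer, at most kn -
1 times, since the last vertex is odd and is not left. So n + 1 ≤ (k+1)π. Likewise the n vertices of
layer 0 are entered inside the layer or from layer 1; layer 1 is left n - 1 times, at least once
towards layer 2, so n ≤ π + n - 2.

Sufficiency. Let the ends lie in layers a ≤ b. If an ordering of layer i is cut into n - r i chains
of H, a walk on the path graph from a to b that visits each i exactly n - r i times lifts to a
hamiltonian path, one chain per visit (`exists_chain_lexProduct`). Such a walk is the direct route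
from a to b with g m back-and-forth detours on each edge {m-1, m} (`hasVisits_pathGraph`). Edges of
H are used in even layers only. The cumulative numbers E j of these edges, with the ends of the path
counted in, determine g by telescoping, and `exists_cumulative_edges` chooses E so that the detours
are nonnegative, vanish at both boundaries, and are positive outside [a, b]. -/

namespace List

/-! ### Counting consecutive pairs in a list -/

variable {α : Type*}

open Classical in
/-- The number of consecutive pairs of a list that satisfy the relation `r`. -/
noncomputable def pairCount (r : α → α → Prop) : List α → ℕ
  | [] => 0
  | [_] => 0
  | a :: b :: l => (if r a b then 1 else 0) + pairCount r (b :: l)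

@[simp] theorem pairCount_nil (r : α → α → Prop) : pairCount r [] = 0 := by
  simp [pairCount]

@[simp] theorem pairCount_singleton (r : α → α → Prop) (a : α) : pairCount r [a] = 0 := by
  simp [pairCount]

open Classical in
theorem pairCount_cons_cons (r : α → α → Prop) (a b : α) (l : List α) :
    pairCount r (a :: b :: l) = (if r a b then 1 else 0) + pairCount r (b :: l) := by
  simp [pairCount]

theorem pairCount_le_cons (r : α → α → Prop) (a : α) (l : List α) :
    pairCount r l ≤ pairCount r (a :: l) := by
  cases l with
  | nil => simp
  | cons b l => rw [pairCount_cons_cons]; omega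

theorem pairCount_append_cons (r : α → α → Prop) (u : List α) (a : α) (v : List α) :
    pairCount r (u ++ a :: v) = pairCount r (u ++ [a]) + pairCount r (a :: v) := by
  induction u with
  | nil => simp
  | cons c u ih =>
    cases u with
    | nil => simp [pairCount_cons_cons]
    | cons d u => simp only [cons_append, pairCount_cons_cons] at ih ⊢; omega

theorem pairCount_concat (r : α → α → Prop) (u : List α) (a : α) :
    pairCount r u ≤ pairCount r (u ++ [a]) ∧ pairCount r (u ++ [a]) ≤ pairCount r u + 1 := by
  induction u with
  | nil => simp
  | cons c u ih =>
    cases u with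
    | nil => simp [pairCount_cons_cons]; split_ifs <;> omega
    | cons d u => simp only [cons_append, pairCount_cons_cons] at ih ⊢; omega

theorem pairCount_add_le_append (r : α → α → Prop) (u v : List α) :
    pairCount r u + pairCount r v ≤ pairCount r (u ++ v) := by
  cases v with
  | nil => simp
  | cons a v =>
    rw [pairCount_append_cons]
    have := (pairCount_concat r u a).1
    omega

theorem pairCount_append_le (r : α → α → Prop) (u v : List α) :
    pairCount r (u ++ v) ≤ pairCount r u + pairCount r v + 1 := by
  cases v with
  | nil => simp
  | cons a v =>
    rw [pairCount_append_cons]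
    have := (pairCount_concat r u a).2
    omega

theorem pairCount_reverse {r : α → α → Prop} (hr : ∀ a b, r a b ↔ r b a) (l : List α) :
    pairCount r l.reverse = pairCount r l := by
  induction l with
  | nil => simp
  | cons a l ih =>
    cases l with
    | nil => simp
    | cons b l =>
      rw [reverse_cons, reverse_cons, append_assoc, singleton_append, pairCount_append_cons,
        ← reverse_cons, ih, pairCount_cons_cons, pairCount_cons_cons, pairCount_singleton]
      have := hr a b
      split_ifs <;> first | omega | tauto

theorem pairCount_le_add {R r s t : α → α → Prop} {l : List α} (hl : l.IsChain R)
    (h : ∀ a b, R a b → r a b → s a b ∨ t a b) :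
    pairCount r l ≤ pairCount s l + pairCount t l := by
  induction l with
  | nil => simp
  | cons a l ih =>
    cases l with
    | nil => simp
    | cons b l =>
      rw [isChain_cons_cons] at hl
      have := ih hl.2
      have := h a b hl.1
      simp only [pairCount_cons_cons]
      split_ifs <;> first | omega | tauto

theorem pairCount_mono {R r s : α → α → Prop} {l : List α} (hl : l.IsChain R)
    (h : ∀ a b, R a b → r a b → s a b) : pairCount r l ≤ pairCount s l := by
  induction l with
  | nil => simp
  | cons a l ih =>
    cases l with
    | nil => simp
    | cons b l =>
      rw [isChain_cons_cons] at hl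
      have := ih hl.2
      have := h a b hl.1
      simp only [pairCount_cons_cons]
      split_ifs <;> first | omega | tauto

theorem pairCount_add_le {r s t : α → α → Prop} (h₁ : ∀ a b, s a b → r a b)
    (h₂ : ∀ a b, t a b → r a b) (h : ∀ a b, s a b → ¬ t a b) (l : List α) :
    pairCount s l + pairCount t l ≤ pairCount r l := by
  induction l with
  | nil => simp
  | cons a l ih =>
    cases l with
    | nil => simp
    | cons b l =>
      have := h a b
      have := h₁ a b
      have := h₂ a b
      simp only [pairCount_cons_cons]
      split_ifs <;> first | omega | tauto

/-- Every entry but the first is entered by exactly one step. This and its mirror image for steps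
that leave an entry turn vertex counts into step counts. -/
theorem countP_tail_eq_pairCount (p : α → Prop) [DecidablePred p] (a : α) (l : List α) :
    countP (fun x => decide (p x)) l = pairCount (fun _ y => p y) (a :: l) := by
  induction l generalizing a with
  | nil => simp
  | cons b l ih =>
    rw [pairCount_cons_cons, ← ih, countP_cons]
    by_cases h : p b <;> simp [h, add_comm]

theorem countP_dropLast_eq_pairCount (p : α → Prop) [DecidablePred p] (l : List α) :
    countP (fun x => decide (p x)) l.dropLast = pairCount (fun x _ => p x) l := by
  induction l with
  | nil => simp
  | cons a l ih =>
    cases l with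
    | nil => simp
    | cons b l =>
      rw [pairCount_cons_cons, ← ih, dropLast_cons_cons, countP_cons]
      by_cases h : p a <;> simp [h, add_comm]

theorem pairCount_pos_of_head_of_mem {p : α → Prop} {a : α} {l : List α} (ha : ¬ p a)
    (hl : ∃ x ∈ l, p x) : 0 < pairCount (fun x y => ¬ p x ∧ p y) (a :: l) := by
  induction l generalizing a with
  | nil => simp at hl
  | cons b l ih =>
    rw [pairCount_cons_cons]
    by_cases hb : p b
    · simp [ha, hb]
    · have := ih hb (by simpa [hb] using hl)
      omega

/-- A list with at least `m` consecutive `r`-pairs can be cut into `l.length - m` chains. -/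
theorem exists_flatten_eq_of_le_pairCount {r : α → α → Prop} {l : List α} {m : ℕ}
    (hm : m ≤ pairCount r l) :
    ∃ L : List (List α), L.flatten = l ∧ L.length + m = l.length ∧
      ∀ S ∈ L, S ≠ [] ∧ S.IsChain r := by
  induction l generalizing m with
  | nil => exact ⟨[], by simpa using hm⟩
  | cons a l ih =>
    by_cases h : m ≤ pairCount r l
    · obtain ⟨L, h₁, h₂, h₃⟩ := ih h
      refine ⟨[a] :: L, by simp [h₁], by simp; omega, ?_⟩
      simpa using h₃
    · cases l with
      | nil => simp at hm h; omega
      | cons b l =>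
        rw [pairCount_cons_cons] at hm
        split_ifs at hm with hab
        · obtain ⟨L, h₁, h₂, h₃⟩ := ih (m := m - 1) (by omega)
          rcases L with _ | ⟨S, L⟩
          · simp at h₁
          · rcases S with _ | ⟨c, S⟩
            · simp at h₃
            · obtain rfl : c = b := by simp at h₁; exact h₁.1
              refine ⟨(a :: c :: S) :: L, by simpa using h₁, by simp at h₂ ⊢; omega, ?_⟩
              simp only [mem_cons, forall_eq_or_imp] at h₃ ⊢
              exact ⟨⟨by simp, isChain_cons_cons.2 ⟨hab, h₃.1.2⟩⟩, h₃.2⟩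
        · omega

end List

/-! ### Linear forests as orderings of the vertices -/

namespace SimpleGraph

variable {V : Type*}

open Classical in
/-- The edges of `H` between consecutive elements of a list. -/
noncomputable def consecutiveEdges (H : SimpleGraph V) : List V → List (Sym2 V)
  | [] => []
  | [_] => []
  | a :: b :: l =>
    if H.Adj a b then s(a, b) :: consecutiveEdges H (b :: l) else consecutiveEdges H (b :: l)

theorem length_consecutiveEdges (H : SimpleGraph V) (l : List V) :
    (H.consecutiveEdges l).length = l.pairCount H.Adj := by
  induction l with
  | nil => simp [consecutiveEdges]
  | cons a l ih =>
    cases l with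
    | nil => simp [consecutiveEdges]
    | cons b l =>
      rw [consecutiveEdges, List.pairCount_cons_cons, ← ih]
      split_ifs <;> simp [add_comm]

theorem mem_consecutiveEdges {H : SimpleGraph V} {l : List V} {e : Sym2 V} :
    e ∈ H.consecutiveEdges l ↔ ∃ u v, [u, v] <:+: l ∧ H.Adj u v ∧ e = s(u, v) := by
  induction l with
  | nil => simp [consecutiveEdges]
  | cons a l ih =>
    cases l with
    | nil =>
      simp only [consecutiveEdges, List.not_mem_nil, false_iff, not_exists]
      rintro u v ⟨h, -⟩
      simpa using h.length_le
    | cons b l =>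
      have key : ∀ u v, [u, v] <:+: a :: b :: l ↔ (u = a ∧ v = b) ∨ [u, v] <:+: b :: l := by
        intro u v
        rw [List.infix_cons_iff]
        simp
      simp only [key]
      rw [consecutiveEdges]
      split_ifs with hab
      · rw [List.mem_cons, ih]
        constructor
        · rintro (rfl | ⟨u, v, h⟩)
          · exact ⟨a, b, Or.inl ⟨rfl, rfl⟩, hab, rfl⟩
          · exact ⟨u, v, Or.inr h.1, h.2⟩
        · rintro ⟨u, v, ⟨rfl, rfl⟩ | h, h'⟩
          · exact Or.inl h'.2
          · exact Or.inr ⟨u, v, h, h'⟩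
      · rw [ih]
        constructor
        · rintro ⟨u, v, h⟩
          exact ⟨u, v, Or.inr h.1, h.2⟩
        · rintro ⟨u, v, ⟨rfl, rfl⟩ | h, h'⟩
          · exact absurd h'.1 hab
          · exact ⟨u, v, h, h'⟩

theorem nodup_consecutiveEdges (H : SimpleGraph V) {l : List V} (hl : l.Nodup) :
    (H.consecutiveEdges l).Nodup := by
  induction l with
  | nil => simp [consecutiveEdges]
  | cons a l ih =>
    cases l with
    | nil => simp [consecutiveEdges]
    | cons b l =>
      rw [List.nodup_cons] at hl
      rw [consecutiveEdges]
      split_ifs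
      · refine List.nodup_cons.2 ⟨fun h => hl.1 ?_, ih hl.2⟩
        obtain ⟨u, v, huv, -, he⟩ := mem_consecutiveEdges.1 h
        have : a ∈ s(u, v) := he ▸ Sym2.mem_mk_left a b
        rcases Sym2.mem_iff.1 this with rfl | rfl <;> exact huv.subset (by simp)
      · exact ih hl.2

section LinearForest

variable {F : SimpleGraph V} {f : V → ℕ}

/-- A walk whose steps change the label by one crosses every intermediate level. -/
theorem Reachable.exists_adj_of_le_of_lt
    (hadj : ∀ u v, F.Adj u v → f u + 1 = f v ∨ f v + 1 = f u) {u v : V} (h : F.Reachable u v)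
    {j : ℕ} (hu : f u ≤ j) (hv : j < f v) : ∃ a b, F.Adj a b ∧ f a = j ∧ f b = j + 1 := by
  obtain ⟨p⟩ := h
  induction p with
  | nil => omega
  | @cons x y z hxy p ih =>
    by_cases hy : f y ≤ j
    · exact ih hy hv
    · exact ⟨x, y, hxy, by have := hadj x y hxy; omega, by have := hadj x y hxy; omega⟩

theorem exists_reachable_of_between (hf : Function.Injective f)
    (hadj : ∀ u v, F.Adj u v → f u + 1 = f v ∨ f v + 1 = f u) {u v : V} (h : F.Reachable u v)
    {j : ℕ} (hu : f u ≤ j) (hv : j ≤ f v) : ∃ w, f w = j ∧ F.Reachable u w := by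
  induction j, hu using Nat.le_induction with
  | base => exact ⟨u, rfl, Reachable.refl u⟩
  | succ j hj ih =>
    obtain ⟨w, hw, huw⟩ := ih (by omega)
    obtain ⟨a, b, hab, ha, hb⟩ := h.exists_adj_of_le_of_lt hadj hj hv
    obtain rfl : w = a := hf (hw.trans ha.symm)
    exact ⟨b, hb, huw.trans hab.reachable⟩

/-- By injectivity, only one edge can join levels j and j + 1. Deleting it leaves no way across, so
every edge is a bridge. -/
theorem isAcyclic_of_adj_label (hf : Function.Injective f)
    (hadj : ∀ u v, F.Adj u v → f u + 1 = f v ∨ f v + 1 = f u) : F.IsAcyclic := by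
  have key : ∀ u v, F.Adj u v → f u + 1 = f v →
      ¬ (F.deleteEdges {s(u, v)}).Reachable u v := by
    intro u v _ huv hr
    obtain ⟨a, b, hab, ha, hb⟩ := hr.exists_adj_of_le_of_lt (f := f) (j := f u)
      (fun x y hxy => hadj x y (F.deleteEdges_le _ hxy)) le_rfl (by omega)
    obtain rfl := hf ha
    obtain rfl : b = v := hf (by omega)
    simp at hab
  rw [isAcyclic_iff_forall_isBridge]
  intro e he
  induction e with
  | _ u v =>
    rw [isBridge_iff]
    rcases hadj u v he with h | h
    · exact key u v he h
    · intro hr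
      refine key v u he.symm h ?_
      rw [Sym2.eq_swap]
      exact hr.symm

/-- Connectedness makes the labels of a component an interval without gaps, so subtracting the least
label identifies the component with a path graph. -/
theorem isLinearForest_of_adj_label [Finite V] (hf : Function.Injective f)
    (hadj : ∀ u v, F.Adj u v → f u + 1 = f v ∨ f v + 1 = f u) : F.IsLinearForest := by
  classical
  refine ⟨isAcyclic_of_adj_label hf hadj, fun c => ?_⟩
  have hreach : ∀ u v : V, u ∈ c → v ∈ c → F.Reachable u v := fun u v hu hv =>
    ConnectedComponent.exact (hu.trans hv.symm)
  have hfin : (f '' {v | v ∈ c}).Finite := Set.toFinite _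
  obtain ⟨v₀, hv₀⟩ := c.exists_rep
  have hne : (f '' {v | v ∈ c}).Nonempty := ⟨f v₀, v₀, hv₀, rfl⟩
  obtain ⟨p, ⟨a, ha, rfl⟩, hmin⟩ := Set.exists_min_image _ id hfin hne
  obtain ⟨q, ⟨b, hb, rfl⟩, hmax⟩ := Set.exists_max_image _ id hfin hne
  simp only [Set.forall_mem_image, Set.mem_ofPred_eq, id] at hmin hmax ha hb
  refine ⟨f b + 1 - f a, ⟨⟨Equiv.ofBijective
    (fun v : c => (⟨f v.1 - f a, ?_⟩ : Fin (f b + 1 - f a))) ⟨?_, ?_⟩, ?_⟩⟩⟩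
  · have := hmin v.2
    have := hmax v.2
    omega
  · intro v w hvw
    have h₁ := hmin v.2
    have h₂ := hmin w.2
    simp only [Fin.mk.injEq] at hvw
    exact Subtype.ext (hf (by omega))
  · intro i
    obtain ⟨w, hw, haw⟩ := exists_reachable_of_between hf hadj (hreach a b ha hb)
      (j := f a + i) (by omega) (by have := i.2; omega)
    refine ⟨⟨w, ?_⟩, ?_⟩
    · exact (ConnectedComponent.sound haw).symm.trans ha
    · ext; simp [hw]
  · intro v w
    have h₁ := hmin v.2
    have h₂ := hmin w.2
    have step : ∀ v w : V, v ∈ c → w ∈ c → f v + 1 = f w → F.Adj v w := by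
      intro v w hv hw h
      obtain ⟨x, y, hxy, hx, hy⟩ := (hreach v w hv hw).exists_adj_of_le_of_lt hadj
        (j := f v) le_rfl (by omega)
      obtain rfl := hf hx
      obtain rfl : y = w := hf (by omega)
      exact hxy
    rw [pathGraph_adj]
    change (f v.1 - f a + 1 = f w.1 - f a ∨ f w.1 - f a + 1 = f v.1 - f a) ↔ F.Adj v.1 w.1
    constructor
    · rintro (h | h)
      · exact step _ _ v.2 w.2 (by omega)
      · exact (step _ _ w.2 v.2 (by omega)).symm
    · intro h
      have := hadj _ _ h
      omega

end LinearForest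

theorem ncard_edgeSet_le_maxLinearForest [Finite V] {H F : SimpleGraph V} (hle : F ≤ H)
    (hF : F.IsLinearForest) : F.edgeSet.ncard ≤ H.maxLinearForest := by
  refine le_csSup ⟨H.edgeSet.ncard, ?_⟩ ⟨F, hle, hF, rfl⟩
  rintro m ⟨F', hF', -, rfl⟩
  exact Set.ncard_le_ncard (edgeSet_mono hF') (Set.toFinite _)

theorem exists_isLinearForest_ncard_eq_maxLinearForest [Finite V] (H : SimpleGraph V) :
    ∃ F ≤ H, F.IsLinearForest ∧ F.edgeSet.ncard = H.maxLinearForest := by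
  have hbdd : BddAbove {m : ℕ | ∃ F : SimpleGraph V, F ≤ H ∧ F.IsLinearForest ∧
      F.edgeSet.ncard = m} := by
    refine ⟨H.edgeSet.ncard, ?_⟩
    rintro m ⟨F', hF', -, rfl⟩
    exact Set.ncard_le_ncard (edgeSet_mono hF') (Set.toFinite _)
  have hne : {m : ℕ | ∃ F : SimpleGraph V, F ≤ H ∧ F.IsLinearForest ∧
      F.edgeSet.ncard = m}.Nonempty := by
    obtain ⟨n, ⟨e⟩⟩ := Finite.exists_equiv_fin V
    exact ⟨_, ⊥, bot_le, isLinearForest_of_adj_label (f := fun v => (e v : ℕ))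
      (Fin.val_injective.comp e.injective) (by simp), rfl⟩
  exact Nat.sSup_mem hne hbdd

/-- The H-edges between neighbours in the ordering form a linear forest, labelled by position in the
list. -/
theorem pairCount_le_maxLinearForest [Finite V] (H : SimpleGraph V) {l : List V} (hl : l.Nodup)
    (hmem : ∀ v, v ∈ l) : l.pairCount H.Adj ≤ H.maxLinearForest := by
  classical
  let F : SimpleGraph V := fromEdgeSet {e | e ∈ H.consecutiveEdges l}
  have hset : F.edgeSet = {e | e ∈ H.consecutiveEdges l} := by
    rw [edgeSet_fromEdgeSet, sdiff_eq_left, Set.disjoint_left]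
    intro e he
    obtain ⟨u, v, -, h, rfl⟩ := mem_consecutiveEdges.1 he
    simpa using h.ne
  have hadj : ∀ u v, F.Adj u v → l.idxOf u + 1 = l.idxOf v ∨ l.idxOf v + 1 = l.idxOf u := by
    have key : ∀ u v, [u, v] <:+: l → l.idxOf u + 1 = l.idxOf v := by
      rintro u v ⟨s, t, rfl⟩
      have h₁ : u ∉ s := fun h => by
        simp only [List.append_assoc, List.nodup_append] at hl
        exact hl.2.2 u h u (by simp) rfl
      have h₂ : v ∉ s := fun h => by
        simp only [List.append_assoc, List.nodup_append] at hl
        exact hl.2.2 v h v (by simp) rfl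
      have h₃ : u ≠ v := by
        rintro rfl
        simp [List.nodup_append] at hl
      simp [List.idxOf_append, h₁, h₂, h₃, add_comm]
    intro u v huv
    have : s(u, v) ∈ F.edgeSet := huv
    rw [hset] at this
    obtain ⟨x, y, hxy, -, he⟩ := mem_consecutiveEdges.1 this
    rcases Sym2.eq_iff.1 he with ⟨rfl, rfl⟩ | ⟨rfl, rfl⟩
    · exact Or.inl (key _ _ hxy)
    · exact Or.inr (key _ _ hxy)
  have hF : F.IsLinearForest :=
    isLinearForest_of_adj_label (fun u v h => (List.idxOf_inj (hmem u)).1 h) hadj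
  have hle : F ≤ H := by
    rw [← edgeSet_subset_edgeSet, hset]
    intro e he
    obtain ⟨u, v, -, h, rfl⟩ := mem_consecutiveEdges.1 he
    exact h
  have := ncard_edgeSet_le_maxLinearForest hle hF
  rwa [hset, ← List.coe_toFinset, Set.ncard_coe_finset,
    List.toFinset_card_of_nodup (H.nodup_consecutiveEdges hl), length_consecutiveEdges] at this

/-- List the components of an optimal forest one after another, each in path order; every forest
edge then joins consecutive entries. -/
theorem exists_maxLinearForest_le_pairCount [Finite V] (H : SimpleGraph V) :
    ∃ l : List V, l.Nodup ∧ (∀ v, v ∈ l) ∧ H.maxLinearForest ≤ l.pairCount H.Adj := by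
  classical
  obtain ⟨F, hle, ⟨-, hF⟩, hcard⟩ := H.exists_isLinearForest_ncard_eq_maxLinearForest
  choose n e using hF
  replace e := fun c => (e c).some
  have := Fintype.ofFinite F.ConnectedComponent
  let L : F.ConnectedComponent → List V := fun c => List.ofFn fun i => ((e c).symm i).1
  have hL : ∀ c v, v ∈ L c ↔ v ∈ c := by
    intro c v
    simp only [L, List.mem_ofFn]
    constructor
    · rintro ⟨i, rfl⟩
      exact ((e c).symm i).2
    · intro hv
      exact ⟨e c ⟨v, hv⟩, by simp⟩
  refine ⟨Finset.univ.toList.flatMap L, ?_, ?_, ?_⟩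
  · rw [List.nodup_flatMap]
    refine ⟨fun c _ => List.nodup_ofFn.2
      (Subtype.val_injective.comp (e c).symm.injective), ?_⟩
    refine (Finset.nodup_toList _).imp fun {c d} hcd => ?_
    rw [Function.onFun, List.disjoint_left]
    intro v hc hd
    rw [hL] at hc hd
    exact hcd (hc.symm.trans hd)
  · intro v
    simp only [List.mem_flatMap, Finset.mem_toList, Finset.mem_univ, true_and, hL]
    exact ⟨F.connectedComponentMk v, rfl⟩
  · rw [← hcard, ← length_consecutiveEdges]
    have hsub : F.edgeSet ⊆ {x | x ∈ H.consecutiveEdges (Finset.univ.toList.flatMap L)} := by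
      intro x hx
      induction x with
      | _ u v =>
        have hu : u ∈ F.connectedComponentMk u := rfl
        have hv : v ∈ F.connectedComponentMk u :=
          (ConnectedComponent.sound (Adj.reachable hx)).symm
        set c := F.connectedComponentMk u
        have hadj : (pathGraph (n c)).Adj (e c ⟨u, hu⟩) (e c ⟨v, hv⟩) :=
          (e c).map_adj_iff.2 hx
        have key : ∀ i j : Fin (n c), i.1 + 1 = j.1 →
            [((e c).symm i).1, ((e c).symm j).1] <:+: Finset.univ.toList.flatMap L := by
          intro i j hij
          have h₁ : [((e c).symm i).1, ((e c).symm j).1] <:+: L c := by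
            rw [List.infix_iff_getElem?]
            refine ⟨i.1, by simp [L]; omega, fun m hm => ?_⟩
            have : m = 0 ∨ m = 1 := by simp at hm; omega
            rcases this with rfl | rfl
            · simp [L]
            · have : 1 + i.1 = j.1 := by omega
              simp [L, this]
          obtain ⟨s, t, hst⟩ := List.append_of_mem (Finset.mem_toList.2 (Finset.mem_univ c))
          rw [hst, List.flatMap_append, List.flatMap_cons]
          exact h₁.trans ⟨s.flatMap L, t.flatMap L, by simp⟩
        refine mem_consecutiveEdges.2 ?_
        rw [pathGraph_adj] at hadj
        rcases hadj with h | h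
        · exact ⟨u, v, by simpa using key _ _ h, hle hx, rfl⟩
        · exact ⟨v, u, by simpa using key _ _ h, (hle hx).symm, Sym2.eq_swap⟩
    refine (Set.ncard_le_ncard hsub (Set.toFinite _)).trans ?_
    rw [← List.coe_toFinset, Set.ncard_coe_finset]
    exact List.toFinset_card_le _

/-- Prescribing the first vertex of an ordering costs at most one edge. -/
theorem exists_ordering_head [Finite V] (H : SimpleGraph V) (x : V) :
    ∃ l : List V, (x :: l).Nodup ∧ (∀ v, v ∈ x :: l) ∧
      H.maxLinearForest ≤ (x :: l).pairCount H.Adj + 1 := by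
  obtain ⟨l, hl, hmem, hcount⟩ := H.exists_maxLinearForest_le_pairCount
  obtain ⟨u, v, rfl⟩ := List.append_of_mem (hmem x)
  -- Swapping the two blocks of the ordering loses at most the pair at the cut just before `x`.
  have hperm : (x :: (v ++ u)).Perm (u ++ x :: v) := by
    rw [← List.cons_append]; exact List.perm_append_comm
  refine ⟨v ++ u, hperm.nodup_iff.2 hl, fun w => hperm.mem_iff.2 (hmem w), ?_⟩
  have h₁ := List.pairCount_append_le H.Adj u (x :: v)
  have h₂ := List.pairCount_add_le_append H.Adj (x :: v) u
  rw [List.cons_append] at h₂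
  omega

theorem exists_ordering_last [Finite V] (H : SimpleGraph V) (y : V) :
    ∃ l : List V, (l ++ [y]).Nodup ∧ (∀ v, v ∈ l ++ [y]) ∧
      H.maxLinearForest ≤ (l ++ [y]).pairCount H.Adj + 1 := by
  obtain ⟨l, hl, hmem, hcount⟩ := H.exists_ordering_head y
  refine ⟨l.reverse, ?_, ?_, ?_⟩
  · rw [← List.reverse_cons]; exact List.nodup_reverse.2 hl
  · intro v; rw [← List.reverse_cons]; exact List.mem_reverse.2 (hmem v)
  · rwa [← List.reverse_cons, List.pairCount_reverse (fun a b => H.adj_comm a b)]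

theorem exists_ordering_head_last [Finite V] (H : SimpleGraph V) {x y : V} (hxy : x ≠ y) :
    ∃ l : List V, (x :: (l ++ [y])).Nodup ∧ (∀ v, v ∈ x :: (l ++ [y])) ∧
      H.maxLinearForest ≤ (x :: (l ++ [y])).pairCount H.Adj + 2 := by
  obtain ⟨l, hl, hmem, hcount⟩ := H.exists_ordering_head x
  have hy : y ∈ l := by simpa [hxy.symm] using hmem y
  obtain ⟨u, v, rfl⟩ := List.append_of_mem hy
  -- Reversing the tail that starts at `y` puts `y` last and again breaks only one pair.
  have hperm : (x :: (u ++ v.reverse ++ [y])).Perm (x :: (u ++ y :: v)) := by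
    rw [List.append_assoc, ← List.reverse_cons]
    exact ((List.reverse_perm _).append_left u).cons x
  refine ⟨u ++ v.reverse, hperm.nodup_iff.2 hl, fun w => hperm.mem_iff.2 (hmem w), ?_⟩
  have h₁ := List.pairCount_append_le H.Adj (x :: u) (y :: v)
  have h₂ := List.pairCount_add_le_append H.Adj (x :: u) (y :: v).reverse
  rw [List.pairCount_reverse (fun a b => H.adj_comm a b)] at h₂
  simp only [List.cons_append, List.reverse_cons, List.append_assoc] at h₁ h₂ ⊢
  omega

end SimpleGraph

/-! ### Necessity: counting steps of a hamiltonian path -/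

namespace SimpleGraph

variable {V ι : Type*}

theorem _root_.List.countP_eq_card_filter {α : Type*} [Fintype α] {l : List α} (hl : l.Nodup)
    (hmem : ∀ a, a ∈ l) (p : α → Prop) [DecidablePred p] :
    l.countP (fun a => decide (p a)) = (Finset.univ.filter p).card := by
  classical
  rw [List.countP_eq_length_filter, ← List.toFinset_card_of_nodup (hl.filter _)]
  congr 1
  ext a
  simp [hmem a]

-- A step inside layer `i` is an H-edge, and its two ends stay consecutive when the other layers are
-- erased. Erasing may create further adjacent pairs, hence only an inequality.
open Classical in
theorem pairCount_layer_le_pairCount_map_filter {G : SimpleGraph ι} {H : SimpleGraph V}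
    {l : List (ι × V)} (hl : l.IsChain (G.lexProduct H).Adj) (i : ι) :
    l.pairCount (fun x y => x.1 = i ∧ y.1 = i) ≤
      ((l.filter fun x => x.1 = i).map Prod.snd).pairCount H.Adj := by
  induction l with
  | nil => simp
  | cons a l ih =>
    cases l with
    | nil => simp
    | cons b l =>
      rw [List.isChain_cons_cons] at hl
      have ih := ih hl.2
      rw [List.pairCount_cons_cons]
      by_cases ha : a.1 = i
      · by_cases hb : b.1 = i
        · have hab : H.Adj a.2 b.2 := by
            rcases hl.1 with h | h
            · rw [ha, hb] at h
              exact absurd h (G.loopless.irrefl i)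
            · exact h.2
          simp only [List.filter_cons, ha, hb, decide_true, if_true, List.map_cons,
            List.pairCount_cons_cons, and_self, hab] at ih ⊢
          omega
        · rw [if_neg (by tauto), zero_add]
          refine ih.trans ?_
          rw [List.filter_cons_of_pos (a := a) (by simpa using ha), List.map_cons]
          exact List.pairCount_le_cons _ _ _
      · rw [if_neg (by tauto), zero_add, List.filter_cons_of_neg (by simpa using ha)]
        exact ih

theorem pairCount_layer_le_maxLinearForest [Finite V] {G : SimpleGraph ι} {H : SimpleGraph V}
    {l : List (ι × V)} (hl : l.IsChain (G.lexProduct H).Adj) (hnd : l.Nodup)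
    (hmem : ∀ x, x ∈ l) (i : ι) :
    l.pairCount (fun x y => x.1 = i ∧ y.1 = i) ≤ H.maxLinearForest := by
  classical
  refine (pairCount_layer_le_pairCount_map_filter hl i).trans
    (H.pairCount_le_maxLinearForest ?_ ?_)
  · refine (List.nodup_map_iff_inj_on (hnd.filter _)).2 ?_
    intro x hx y hy hxy
    simp only [List.mem_filter, decide_eq_true_eq] at hx hy
    exact Prod.ext (hx.2.trans hy.2.symm) hxy
  · intro v
    simp only [List.mem_map, List.mem_filter, decide_eq_true_eq]
    exact ⟨(i, v), ⟨hmem _, rfl⟩, rfl⟩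

/-- Pairs inside some layer of a family are counted layer by layer. -/
theorem pairCount_le_sum_layers (l : List (ι × V)) (s : Finset ι) :
    l.pairCount (fun x y => x.1 = y.1 ∧ x.1 ∈ s) ≤
      ∑ i ∈ s, l.pairCount (fun x y => x.1 = i ∧ y.1 = i) := by
  induction l with
  | nil => simp
  | cons a l ih =>
    cases l with
    | nil => simp
    | cons b l =>
      simp only [List.pairCount_cons_cons, Finset.sum_add_distrib]
      refine add_le_add ?_ ih
      split_ifs with h
      · refine le_trans ?_ (Finset.single_le_sum (fun _ _ => Nat.zero_le _) h.2)
        rw [if_pos ⟨rfl, h.1.symm⟩]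
      · exact Nat.zero_le _

section Path

variable {k : ℕ} {H : SimpleGraph V}

theorem lexProduct_pathGraph_adj {n : ℕ} {x y : Fin n × V}
    (h : ((pathGraph n).lexProduct H).Adj x y) :
    x.1 = y.1 ∨ x.1.1 + 1 = y.1.1 ∨ y.1.1 + 1 = x.1.1 := by
  rcases h with h | h
  · exact Or.inr (pathGraph_adj.1 h)
  · exact Or.inl h.1

variable [Fintype V]

theorem card_filter_layer {n : ℕ} (i : Fin n) :
    (Finset.univ.filter fun x : Fin n × V => x.1 = i).card = Fintype.card V := by
  rw [← Finset.card_univ (α := V), ← Finset.card_map (Function.Embedding.sectR i V)]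
  congr 1
  ext ⟨j, v⟩
  simp [Prod.ext_iff, eq_comm]

/-- A hamiltonian path with both ends in odd-indexed layers needs many edges inside the
even-indexed layers. -/
theorem card_add_one_le_of_chain {l : List (Fin (2 * k + 1) × V)}
    (hl : l.IsChain ((pathGraph (2 * k + 1)).lexProduct H).Adj) (hnd : l.Nodup)
    (hmem : ∀ x, x ∈ l) {a b : Fin (2 * k + 1) × V} (ha : l.head? = some a)
    (hb : l.getLast? = some b) (ha1 : a.1.1 % 2 = 1) (hb1 : b.1.1 % 2 = 1) :
    Fintype.card V + 1 ≤ (k + 1) * H.maxLinearForest := by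
  classical
  let E : Finset (Fin (2 * k + 1)) := Finset.univ.filter fun i => i.1 % 2 = 0
  have hE : E.card = k + 1 := by
    rw [← Fintype.card_fin (k + 1), ← Finset.card_univ]
    refine Finset.card_bij' (fun i _ => ⟨i.1 / 2, by have := i.2; omega⟩)
      (fun j _ => ⟨2 * j.1, by have := j.2; omega⟩) ?_ ?_ ?_ ?_
    · simp
    · simp [E]
    · intro i hi
      ext
      simp [E] at hi ⊢
      omega
    · intro j _
      ext
      simp
  have hS : l.countP (fun x => decide (x.1 ∈ E)) = (k + 1) * Fintype.card V := by
    rw [List.countP_eq_card_filter hnd hmem, ← hE, ← Finset.card_univ (α := V),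
      ← Finset.card_product]
    congr 1
    ext x
    simp
  have hlen : l.length = (2 * k + 1) * Fintype.card V := by
    rw [← List.toFinset_card_of_nodup hnd,
      Finset.eq_univ_of_forall (s := l.toFinset) (fun x => by simpa using hmem x)]
    simp
  have hT : l.countP (fun x => decide (x.1 ∉ E)) = k * Fintype.card V := by
    have h := List.length_eq_countP_add_countP (l := l) (fun x => decide (x.1 ∈ E))
    have h' : l.countP (fun x => decide (x.1 ∉ E)) =
        l.countP (fun x => decide ¬(decide (x.1 ∈ E) = true)) := by simp
    rw [h']
    rw [hlen, hS] at h
    have : (2 * k + 1) * Fintype.card V = (k + 1) * Fintype.card V + k * Fintype.card V := by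
      ring
    omega
  have h₁ : l.countP (fun x => decide (x.1 ∈ E)) = l.pairCount (fun _ y => y.1 ∈ E) := by
    obtain ⟨t, rfl⟩ : ∃ t, l = a :: t := List.head?_eq_some_iff.1 ha
    rw [← List.countP_tail_eq_pairCount, List.countP_cons_of_neg]
    simp [E, ha1]
  -- The extra 1 is the last vertex `b`, which lies in an odd layer and is not left by any step.
  have h₂ : l.countP (fun x => decide (x.1 ∉ E)) =
      l.pairCount (fun x _ => x.1 ∉ E) + 1 := by
    obtain ⟨t, rfl⟩ : ∃ t, l = t ++ [b] := List.getLast?_eq_some_iff.1 hb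
    rw [← List.countP_dropLast_eq_pairCount, List.dropLast_concat, List.countP_append,
      List.countP_singleton, if_pos]
    simp [E, hb1]
  have h₃ : l.pairCount (fun _ y => y.1 ∈ E) ≤
      l.pairCount (fun x y => x.1 = y.1 ∧ x.1 ∈ E) + l.pairCount (fun x _ => x.1 ∉ E) := by
    refine List.pairCount_le_add hl fun x y hxy hy => ?_
    by_cases hx : x.1 ∈ E
    · refine Or.inl ⟨?_, hx⟩
      simp only [E, Finset.mem_filter, Finset.mem_univ, true_and] at hx hy
      rcases lexProduct_pathGraph_adj hxy with h | h
      · exact h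
      · omega
    · exact Or.inr hx
  have h₄ : l.pairCount (fun x y => x.1 = y.1 ∧ x.1 ∈ E) ≤ (k + 1) * H.maxLinearForest := by
    refine (pairCount_le_sum_layers l E).trans ?_
    refine (Finset.sum_le_sum fun i _ =>
      pairCount_layer_le_maxLinearForest hl hnd hmem i).trans ?_
    simp [hE]
  have : (k + 1) * Fintype.card V = k * Fintype.card V + Fintype.card V := by ring
  omega

open Classical in
/-- A hamiltonian path starting in the second layer needs edges inside the first layer. -/
theorem one_add_le_maxLinearForest_of_chain (hk : 1 ≤ k) [Nonempty V]
    {l : List (Fin (2 * k + 1) × V)}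
    (hl : l.IsChain ((pathGraph (2 * k + 1)).lexProduct H).Adj) (hnd : l.Nodup)
    (hmem : ∀ x, x ∈ l) {a b : Fin (2 * k + 1) × V} (ha : l.head? = some a)
    (hb : l.getLast? = some b) (ha1 : a.1.1 = 1) :
    1 + (if b.1.1 = 1 then 1 else 0) ≤ H.maxLinearForest := by
  have hS := List.countP_eq_card_filter hnd hmem (fun x => x.1 = ⟨0, by omega⟩)
  have hT := List.countP_eq_card_filter hnd hmem (fun x => x.1 = ⟨1, by omega⟩)
  rw [card_filter_layer] at hS hT
  have h₁ : l.countP (fun x => decide (x.1 = ⟨0, by omega⟩)) =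
      l.pairCount (fun _ y => y.1 = ⟨0, by omega⟩) := by
    obtain ⟨t, rfl⟩ : ∃ t, l = a :: t := List.head?_eq_some_iff.1 ha
    rw [← List.countP_tail_eq_pairCount, List.countP_cons_of_neg]
    simp [Fin.ext_iff, ha1]
  have h₂ : l.countP (fun x => decide (x.1 = ⟨1, by omega⟩)) =
      l.pairCount (fun x _ => x.1 = ⟨1, by omega⟩) + if b.1.1 = 1 then 1 else 0 := by
    obtain ⟨t, rfl⟩ : ∃ t, l = t ++ [b] := List.getLast?_eq_some_iff.1 hb
    rw [← List.countP_dropLast_eq_pairCount, List.dropLast_concat, List.countP_append,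
      List.countP_singleton]
    simp [Fin.ext_iff]
  have h₃ : l.pairCount (fun _ y => y.1 = ⟨0, by omega⟩) ≤
      l.pairCount (fun x y => x.1 = ⟨0, by omega⟩ ∧ y.1 = ⟨0, by omega⟩) +
        l.pairCount (fun x y => x.1 = ⟨1, by omega⟩ ∧ y.1 = ⟨0, by omega⟩) := by
    refine List.pairCount_le_add hl fun x y hxy hy => ?_
    have := lexProduct_pathGraph_adj hxy
    simp only [Fin.ext_iff] at this hy ⊢
    omega
  have h₄ := pairCount_layer_le_maxLinearForest hl hnd hmem ⟨0, by omega⟩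
  -- Layer 2 exists because 1 ≤ k, so the path must at some point rise to it. That step leaves layer
  -- 1 and is lost for entering layer 0.
  have h₅ : 0 < l.pairCount (fun x y => ¬ 2 ≤ x.1.1 ∧ 2 ≤ y.1.1) := by
    obtain ⟨t, rfl⟩ : ∃ t, l = a :: t := List.head?_eq_some_iff.1 ha
    refine List.pairCount_pos_of_head_of_mem (by omega) ?_
    obtain ⟨v⟩ := ‹Nonempty V›
    have h := hmem (⟨2, by omega⟩, v)
    rw [List.mem_cons] at h
    refine ⟨_, h.resolve_left ?_, le_rfl⟩
    intro he
    rw [← he] at ha1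
    simp at ha1
  have h₆ : l.pairCount (fun x y => ¬ 2 ≤ x.1.1 ∧ 2 ≤ y.1.1) ≤
      l.pairCount (fun x y => x.1 = ⟨1, by omega⟩ ∧ 2 ≤ y.1.1) := by
    refine List.pairCount_mono hl fun x y hxy hy => ?_
    have := lexProduct_pathGraph_adj hxy
    simp only [Fin.ext_iff] at this ⊢
    omega
  have h₈ : l.pairCount (fun x y => x.1 = ⟨1, by omega⟩ ∧ y.1 = ⟨0, by omega⟩) +
      l.pairCount (fun x y => x.1 = ⟨1, by omega⟩ ∧ 2 ≤ y.1.1) ≤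
      l.pairCount (fun x _ => x.1 = ⟨1, by omega⟩) := by
    refine List.pairCount_add_le (fun x y h => h.1) (fun x y h => h.1) (fun x y h h' => ?_) l
    simp only [Fin.ext_iff] at h h'
    omega
  omega

theorem maxLinearForest_eq_zero_of_subsingleton [Subsingleton V] (H : SimpleGraph V) :
    H.maxLinearForest = 0 := by
  obtain ⟨F, -, -, h⟩ := H.exists_isLinearForest_ncard_eq_maxLinearForest
  rw [← h, Subsingleton.elim F ⊥]
  simp

theorem chain_of_isHamiltonian {α : Type*} [DecidableEq α] {G : SimpleGraph α} {x y : α}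
    {p : G.Walk x y} (hp : p.IsHamiltonian) :
    p.support.IsChain G.Adj ∧ p.support.Nodup ∧ (∀ z, z ∈ p.support) ∧
      p.support.head? = some x ∧ p.support.getLast? = some y := by
  refine ⟨p.isChain_adj_support, hp.isPath.support_nodup, hp.mem_support, ?_, ?_⟩
  · rw [← p.cons_tail_support]; rfl
  · rw [List.getLast?_eq_some_getLast p.support_ne_nil, p.getLast_support]

theorem IsHamiltonianConnected.bounds [DecidableEq V] [Nonempty V] (hk : 1 ≤ k)
    (h : ((pathGraph (2 * k + 1)).lexProduct H).IsHamiltonianConnected) :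
    2 ≤ H.maxLinearForest ∧ Fintype.card V + 1 ≤ (k + 1) * H.maxLinearForest := by
  rcases subsingleton_or_nontrivial V with hV | hV
  · obtain ⟨v⟩ := ‹Nonempty V›
    -- Layer 1 has no two distinct vertices here. Ending in layer 0 still forces π ≥ 1, while a
    -- single vertex has π = 0.
    obtain ⟨p, hp⟩ := h (⟨1, by omega⟩, v) (⟨0, by omega⟩, v) (by simp)
    obtain ⟨h₁, h₂, h₃, h₄, h₅⟩ := chain_of_isHamiltonian hp
    have := one_add_le_maxLinearForest_of_chain hk h₁ h₂ h₃ h₄ h₅ rfl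
    have := maxLinearForest_eq_zero_of_subsingleton H
    omega
  · obtain ⟨v, w, hvw⟩ := exists_pair_ne V
    obtain ⟨p, hp⟩ := h (⟨1, by omega⟩, v) (⟨1, by omega⟩, w) (by simpa using hvw)
    obtain ⟨h₁, h₂, h₃, h₄, h₅⟩ := chain_of_isHamiltonian hp
    have := one_add_le_maxLinearForest_of_chain hk h₁ h₂ h₃ h₄ h₅ rfl
    exact ⟨by simpa using this, card_add_one_le_of_chain h₁ h₂ h₃ h₄ h₅ rfl rfl⟩

end Path

end SimpleGraph

/-! ### Sufficiency: walks with prescribed visit counts and their lifts -/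

namespace SimpleGraph

variable {V ι : Type*}

section Visits

variable [DecidableEq ι]

/-- There is a walk from `a` to `b` that visits each vertex `i` exactly `c i` times. -/
def HasVisits (G : SimpleGraph ι) (a b : ι) (c : ι → ℕ) : Prop :=
  ∃ w : List ι, w.IsChain G.Adj ∧ w.head? = some a ∧ w.getLast? = some b ∧ ∀ i, w.count i = c i

/-- Replacing one occurrence of `i` by `i, j, i` adds one visit to each of `i` and `j` and keeps the
ends. -/
theorem HasVisits.add_detour {G : SimpleGraph ι} {a b i j : ι} {c : ι → ℕ}
    (h : G.HasVisits a b c) (hi : 0 < c i) (hij : G.Adj i j) (m : ℕ) :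
    G.HasVisits a b fun x => c x + if x = i ∨ x = j then m else 0 := by
  induction m with
  | zero => simpa using h
  | succ m ih =>
    obtain ⟨w, h₁, h₂, h₃, h₄⟩ := ih
    have hmem : i ∈ w := List.count_pos_iff.1 (by rw [h₄]; exact Nat.add_pos_left hi _)
    obtain ⟨u, v, rfl⟩ := List.append_of_mem hmem
    refine ⟨u ++ i :: j :: i :: v, ?_, ?_, ?_, ?_⟩
    · rw [List.isChain_split] at h₁ ⊢
      exact ⟨h₁.1, List.isChain_cons_cons.2 ⟨hij, List.isChain_cons_cons.2 ⟨hij.symm, h₁.2⟩⟩⟩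
    · cases u <;> simpa using h₂
    · rw [← h₃]
      simp [List.getLast?_append, List.getLast?_cons]
    · intro x
      have := h₄ x
      have hne := hij.ne
      simp only [List.count_append, List.count_cons, beq_iff_eq] at this ⊢
      by_cases hxi : x = i
      · subst hxi
        simp [hne.symm] at this ⊢
        omega
      · by_cases hxj : x = j
        · subst hxj
          simp [hne] at this ⊢
          omega
        · simp [hxi, hxj, Ne.symm hxi, Ne.symm hxj] at this ⊢
          omega

theorem hasVisits_pathGraph_interval {n : ℕ} (a b : Fin n) (hab : a ≤ b) :
    (pathGraph n).HasVisits a b fun i => if a ≤ i ∧ i ≤ b then 1 else 0 := by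
  obtain ⟨a, ha⟩ := a
  obtain ⟨b, hb⟩ := b
  simp only [Fin.mk_le_mk] at hab
  induction b, hab using Nat.le_induction with
  | base =>
    refine ⟨[⟨a, ha⟩], by simp, rfl, rfl, fun i => ?_⟩
    rw [List.count_singleton]
    simp only [Fin.ext_iff, Fin.le_def, beq_iff_eq]
    split_ifs <;> omega
  | succ b hab ih =>
    obtain ⟨w, h₁, h₂, h₃, h₄⟩ := ih (by omega)
    refine ⟨w ++ [⟨b + 1, hb⟩], ?_, ?_, by simp, fun i => ?_⟩
    · refine h₁.append (by simp) ?_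
      intro x hx y hy
      rw [h₃] at hx
      simp only [Option.mem_def, Option.some.injEq, List.head?_cons] at hx hy
      subst hx hy
      rw [pathGraph_adj]
      simp
    · simp [h₂]
    · rw [List.count_append, h₄, List.count_singleton]
      simp only [Fin.ext_iff, Fin.le_def, beq_iff_eq]
      split_ifs <;> omega

theorem HasVisits.congr {G : SimpleGraph ι} {a b : ι} {c d : ι → ℕ} (h : G.HasVisits a b c)
    (hcd : ∀ i, c i = d i) : G.HasVisits a b d := by
  rwa [← funext hcd]

/-- Visit counts realized on a path: `g m` is the number of detours along the edge between the
vertices `m - 1` and `m`. -/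
theorem hasVisits_pathGraph {n : ℕ} {a b : Fin n} (hab : a ≤ b) {g : ℕ → ℕ} (h0 : g 0 = 0)
    (hn : g n = 0) (ha : ∀ m, 1 ≤ m → m ≤ a.1 → 0 < g m)
    (hb : ∀ m, b.1 < m → m < n → 0 < g m) :
    (pathGraph n).HasVisits a b fun i =>
      (if a ≤ i ∧ i ≤ b then 1 else 0) + g i + g (i + 1) := by
  have hab' : a.1 ≤ b.1 := hab
  -- Detours are attached edge by edge, upwards from `a` and then downwards, so that the near end of
  -- each edge is already visited: by the direct route up to `b`, and outside [a, b] by the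
  -- preceding positive number of detours.
  have up : ∀ M, a.1 ≤ M → M < n → (pathGraph n).HasVisits a b fun i =>
      (if a ≤ i ∧ i ≤ b then 1 else 0) + (if a.1 < i.1 ∧ i.1 ≤ M then g i else 0) +
        if a.1 < i.1 + 1 ∧ i.1 + 1 ≤ M then g (i + 1) else 0 := by
    intro M hM
    induction M, hM using Nat.le_induction with
    | base =>
      intro _
      refine (hasVisits_pathGraph_interval a b hab).congr fun i => ?_
      simp only [Fin.le_def]
      split_ifs <;> omega
    | succ M hM ih =>
      intro hMn
      refine ((ih (by omega)).add_detour (i := ⟨M, by omega⟩) (j := ⟨M + 1, hMn⟩) ?_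
        (pathGraph_adj.2 (Or.inl rfl)) (g (M + 1))).congr fun i => ?_
      · have := hb M
        simp only [Fin.le_def]
        split_ifs <;> omega
      · obtain ⟨i, hi⟩ := i
        simp only [Fin.le_def, Fin.ext_iff]
        by_cases h₁ : i = M
        · subst h₁
          split_ifs <;> omega
        · by_cases h₂ : i = M + 1
          · subst h₂
            split_ifs <;> omega
          · split_ifs <;> omega
  have down : ∀ d, d ≤ a.1 → (pathGraph n).HasVisits a b fun i =>
      (if a ≤ i ∧ i ≤ b then 1 else 0) + (if a.1 - d < i.1 then g i else 0) +
        if a.1 - d < i.1 + 1 then g (i + 1) else 0 := by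
    intro d
    induction d with
    | zero =>
      intro _
      refine (up (n - 1) (by have := a.2; omega) (by have := a.2; omega)).congr fun i => ?_
      have := i.2
      simp only [Fin.le_def]
      by_cases h : i.1 + 1 = n
      · rw [h, hn]
        split_ifs <;> omega
      · split_ifs <;> omega
    | succ d ih =>
      intro hd
      have := a.2
      have hg : 0 < g (a.1 - d) := ha _ (by omega) (by omega)
      refine ((ih (by omega)).add_detour (i := ⟨a.1 - d, by omega⟩)
        (j := ⟨a.1 - d - 1, by omega⟩) ?_
        (pathGraph_adj.2 (Or.inr (by simp; omega))) (g (a.1 - d))).congr fun i => ?_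
      · simp only [Fin.le_def]
        rcases Nat.eq_zero_or_pos d with rfl | hd0
        · rw [if_pos (by omega)]
          omega
        · have := ha (a.1 - d + 1) (by omega) (by omega)
          split_ifs <;> omega
      · obtain ⟨i, hi⟩ := i
        simp only [Fin.le_def, Fin.ext_iff]
        by_cases h₁ : i = a.1 - d
        · subst h₁
          split_ifs <;> omega
        · by_cases h₂ : i + 1 = a.1 - d
          · rw [← h₂]
            split_ifs <;> omega
          · split_ifs <;> omega
  refine (down a.1 le_rfl).congr fun i => ?_
  by_cases h : i.1 = 0
  · simp [h, h0]
  · simp [Nat.pos_of_ne_zero h]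

/-- Replacing the visits of a walk in `G` by chains of `H` yields a chain of the lexicographic
product. -/
theorem exists_chain_lexProduct [DecidableEq V] {G : SimpleGraph ι} {H : SimpleGraph V}
    (w : List ι) (hw : w.IsChain G.Adj) (L : ι → List (List V))
    (hlen : ∀ i, (L i).length = w.count i) (hL : ∀ i, ∀ S ∈ L i, S ≠ [] ∧ S.IsChain H.Adj) :
    ∃ l : List (ι × V), l.IsChain (G.lexProduct H).Adj ∧
      (∀ i v, l.count (i, v) = (L i).flatten.count v) ∧
      (∀ a, w.head? = some a → l.head? = (L a).flatten.head?.map (Prod.mk a)) ∧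
      (∀ b, w.getLast? = some b → l.getLast? = (L b).flatten.getLast?.map (Prod.mk b)) := by
  induction w generalizing L with
  | nil =>
    refine ⟨[], by simp, fun i v => ?_, by simp, by simp⟩
    have : L i = [] := by simpa using hlen i
    simp [this]
  | cons a w ih =>
    obtain ⟨S, R, hSR⟩ : ∃ S R, L a = S :: R := by
      have := hlen a
      rw [List.count_cons_self] at this
      exact List.exists_cons_of_length_eq_add_one this
    have hS := hL a S (by simp [hSR])
    -- The first visit to `a` consumes the first block of `L a`; later visits take the remaining
    -- blocks in order, so the ends of the concatenated ordering become the ends of the path.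
    obtain ⟨l, h₁, h₂, h₃, h₄⟩ := ih (List.IsChain.tail hw) (Function.update L a R)
      (fun i => by
        have := hlen i
        by_cases hi : i = a
        · subst hi
          simp [hSR] at this ⊢
          exact this
        · rw [Function.update_of_ne hi, this, List.count_cons_of_ne (Ne.symm hi)])
      (fun i T hT => by
        by_cases hi : i = a
        · subst hi
          exact hL i T (by rw [hSR]; exact List.mem_cons_of_mem _ (by simpa using hT))
        · exact hL _ T (by simpa [hi] using hT))
    obtain ⟨s, S, rfl⟩ := List.exists_cons_of_ne_nil hS.1
    refine ⟨(s :: S).map (Prod.mk a) ++ l, ?_, ?_, ?_, ?_⟩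
    · refine List.IsChain.append ?_ h₁ ?_
      · rw [List.isChain_map]
        exact hS.2.imp fun x y h => Or.inr ⟨rfl, h⟩
      · intro x hx y hy
        have hxa : x.1 = a := by
          have := List.mem_of_getLast? hx
          rw [List.mem_map] at this
          obtain ⟨_, _, rfl⟩ := this
          rfl
        cases w with
        | nil =>
          have hl : l.count y = 0 := by
            rw [show y = (y.1, y.2) from rfl, h₂]
            have hz := hlen y.1
            by_cases hya : y.1 = a
            · rw [hya, hSR] at hz
              simp at hz
              simp [hya, hz]
            · rw [List.count_cons_of_ne (Ne.symm hya)] at hz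
              simp at hz
              simp [hya, hz]
          exact absurd (List.mem_of_mem_head? hy) (List.count_eq_zero.1 hl)
        | cons c w =>
          rw [List.isChain_cons_cons] at hw
          have hyc : y.1 = c := by
            have := h₃ c rfl
            rw [this] at hy
            simp only [Option.mem_def, Option.map_eq_some_iff] at hy
            obtain ⟨_, _, rfl⟩ := hy
            rfl
          left
          rw [hxa, hyc]
          exact hw.1
    · intro i v
      rw [List.count_append, h₂]
      by_cases hi : i = a
      · subst hi
        rw [hSR, Function.update_self, List.flatten_cons, List.count_append,
          List.count_map_of_injective _ _ (Prod.mk_right_injective i)]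
      · rw [Function.update_of_ne hi]
        have : List.count (i, v) ((s :: S).map (Prod.mk a)) = 0 := by
          rw [List.count_eq_zero, List.mem_map]
          rintro ⟨_, _, h⟩
          exact hi (congrArg Prod.fst h).symm
        omega
    · intro c hc
      obtain rfl : a = c := by simpa using hc
      simp [hSR]
    · intro b hb
      rcases List.eq_nil_or_concat' w with rfl | ⟨t, d, rfl⟩
      · obtain rfl : a = b := by simpa using hb
        have hR : R = [] := by simpa [hSR] using hlen a
        have hl : l = [] := by
          rw [List.eq_nil_iff_forall_not_mem]
          rintro ⟨i, v⟩
          rw [← List.count_eq_zero, h₂]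
          by_cases hi : i = a
          · simp [hi, hR]
          · have hz := hlen i
            rw [List.count_cons_of_ne (Ne.symm hi)] at hz
            simp at hz
            simp [hi, hz]
        rw [hl, hSR, hR, List.append_nil, List.getLast?_map]
        simp
      · obtain rfl : d = b := by
          rw [← List.cons_append, List.getLast?_concat] at hb
          simpa using hb
        have hlast := h₄ d (by simp)
        have hne : (Function.update L a R d).flatten ≠ [] := by
          have hpos : 0 < (Function.update L a R d).length := by
            have := hlen d
            by_cases hi : d = a
            · subst hi
              simp [hSR] at this ⊢
              omega
            · rw [List.count_cons_of_ne (Ne.symm hi)] at this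
              rw [Function.update_of_ne hi, this, List.count_append]
              simp
          obtain ⟨T, hT⟩ := List.exists_mem_of_length_pos hpos
          have hTne : T ≠ [] := by
            by_cases hi : d = a
            · subst hi
              exact (hL d T (by rw [hSR]; exact List.mem_cons_of_mem _ (by simpa using hT))).1
            · exact (hL _ T (by simpa [hi] using hT)).1
          intro h
          exact hTne (List.flatten_eq_nil_iff.1 h T hT)
        obtain ⟨z, hz⟩ : ∃ z, (Function.update L a R d).flatten.getLast? = some z :=
          ⟨_, List.getLast?_eq_some_getLast hne⟩
        rw [hz] at hlast
        have hz' : (L d).flatten.getLast? = some z := by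
          by_cases hi : d = a
          · subst hi
            rw [Function.update_self] at hz
            rw [hSR, List.flatten_cons, List.getLast?_append, hz]
            rfl
          · rwa [Function.update_of_ne hi] at hz
        rw [List.getLast?_append, hlast, hz']
        rfl

end Visits

/-! ### Choice of the counts and construction of the hamiltonian path -/

theorem maxLinearForest_lt_card [Fintype V] [Nonempty V] (H : SimpleGraph V) :
    H.maxLinearForest < Fintype.card V := by
  classical
  obtain ⟨l, hl, hmem, hcount⟩ := H.exists_maxLinearForest_le_pairCount
  obtain ⟨L, h₁, h₂, -⟩ := List.exists_flatten_eq_of_le_pairCount hcount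
  have hlen : l.length = Fintype.card V := by
    rw [← List.toFinset_card_of_nodup hl,
      Finset.eq_univ_of_forall (s := l.toFinset) (fun x => by simpa using hmem x)]
    simp
  have hpos : 0 < Fintype.card V := Fintype.card_pos
  have : L ≠ [] := by
    rintro rfl
    rw [List.flatten_nil] at h₁
    rw [← h₁, List.length_nil] at hlen
    omega
  have := List.length_pos_iff.2 this
  omega

/-- The cumulative numbers of edges used inside the even-indexed layers, for end vertices in the
layers `a ≤ b`. -/
theorem exists_cumulative_edges {n p k a b : ℕ} (hp : 2 ≤ p) (hpn : p < n)
    (hn : n + 1 ≤ (k + 1) * p) (hab : a ≤ b) (hb : b ≤ 2 * k) :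
    ∃ E : ℕ → ℕ, E 0 = 0 ∧ E (k + 1) = n + 1 ∧
      (∀ j ≤ k, E j + ((if 2 * j = a then 1 else 0) + if 2 * j = b then 1 else 0) ≤ E (j + 1) ∧
        E (j + 1) ≤ E j + p) ∧
      ∀ j, 1 ≤ j → j ≤ k → 1 ≤ E j ∧ E j ≤ n ∧ (b < 2 * j → 2 ≤ E j) ∧
        (2 * j ≤ a + 1 → E j + 1 ≤ n) := by
  -- Greedy growth by `p` under a cap near `n`. The cap rises by one just after `a`, just after `b`
  -- if `b + 2 ≤ 2 * k`, and at `k + 1`, which makes room for ends in even layers and for the final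
  -- value `n + 1`. The guard on `b` keeps the last two rises apart, so the cap never rises by more
  -- than 2 ≤ p in one step.
  refine ⟨fun j => min (j * p) (n - 1 + (if a + 2 ≤ 2 * j then 1 else 0) +
    (if j = k + 1 then 1 else 0) - if 2 * j ≤ b ∧ b + 2 ≤ 2 * k then 1 else 0), ?_, ?_, ?_, ?_⟩
  · simp
  · dsimp only
    split_ifs <;> omega
  · intro j hj
    have h₁ : (j + 1) * p = j * p + p := by ring
    have h₂ : j = k → (j + 1) * p = (k + 1) * p := by rintro rfl; rfl
    have h₃ : j = 0 → j * p = 0 := by rintro rfl; simp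
    dsimp only
    split_ifs <;> omega
  · intro j h₁ h₂
    have h₃ : p ≤ j * p := Nat.le_mul_of_pos_left p h₁
    dsimp only
    split_ifs <;> omega

/-- An ordering of a layer with prescribed ends. -/
theorem exists_ordering_of_ends [Finite V] {ι : Type*} [DecidableEq ι] (H : SimpleGraph V)
    {x y : ι × V} (hxy : x ≠ y) (i : ι) :
    ∃ l : List V, l.Nodup ∧ (∀ v, v ∈ l) ∧
      H.maxLinearForest ≤ l.pairCount H.Adj +
        ((if i = x.1 then 1 else 0) + if i = y.1 then 1 else 0) ∧
      (i = x.1 → l.head? = some x.2) ∧ (i = y.1 → l.getLast? = some y.2) := by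
  by_cases hx : i = x.1
  · by_cases hy : i = y.1
    · obtain ⟨l, h₁, h₂, h₃⟩ := H.exists_ordering_head_last (x := x.2) (y := y.2)
        fun h => hxy (Prod.ext (hx.symm.trans hy) h)
      refine ⟨_, h₁, h₂, by rwa [if_pos hx, if_pos hy], fun _ => rfl, fun _ => ?_⟩
      rw [← List.cons_append, List.getLast?_concat]
    · obtain ⟨l, h₁, h₂, h₃⟩ := H.exists_ordering_head x.2
      exact ⟨_, h₁, h₂, by rwa [if_pos hx, if_neg hy], fun _ => rfl, fun h => absurd h hy⟩
  · by_cases hy : i = y.1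
    · obtain ⟨l, h₁, h₂, h₃⟩ := H.exists_ordering_last y.2
      exact ⟨_, h₁, h₂, by rwa [if_neg hx, if_pos hy], fun h => absurd h hx, fun _ => by simp⟩
    · obtain ⟨l, h₁, h₂, h₃⟩ := H.exists_maxLinearForest_le_pairCount
      exact ⟨l, h₁, h₂, by rwa [if_neg hx, if_neg hy], fun h => absurd h hx,
        fun h => absurd h hy⟩

/-- A walk with suitable visit counts lifts to a hamiltonian path of the lexicographic product. -/
theorem HasVisits.exists_isHamiltonian [Fintype V] [DecidableEq V] [DecidableEq ι]
    {G : SimpleGraph ι} {H : SimpleGraph V} {x y : ι × V} (hxy : x ≠ y) {c r : ι → ℕ}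
    (h : G.HasVisits x.1 y.1 c) (hc : ∀ i, c i + r i = Fintype.card V)
    (hr : ∀ i, r i = 0 ∨
      r i + ((if i = x.1 then 1 else 0) + if i = y.1 then 1 else 0) ≤ H.maxLinearForest) :
    ∃ p : (G.lexProduct H).Walk x y, p.IsHamiltonian := by
  obtain ⟨w, hw, hhead, hlast, hcount⟩ := h
  choose l hnd hmem hl hlx hly using H.exists_ordering_of_ends hxy
  have hrl : ∀ i, r i ≤ (l i).pairCount H.Adj := fun i => by
    have := hr i
    have := hl i
    omega
  choose L h₁ h₂ h₃ using fun i => List.exists_flatten_eq_of_le_pairCount (hrl i)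
  have hlen : ∀ i, (l i).length = Fintype.card V := fun i => by
    rw [← List.toFinset_card_of_nodup (hnd i),
      Finset.eq_univ_of_forall (s := (l i).toFinset) (fun x => by simpa using hmem i x)]
    simp
  obtain ⟨P, hP, hPc, hPh, hPl⟩ := exists_chain_lexProduct w hw L
    (fun i => by have := h₂ i; have := hlen i; have := hc i; have := hcount i; omega) h₃
  have hPx := hPh _ hhead
  have hPy := hPl _ hlast
  rw [h₁, hlx _ rfl] at hPx
  rw [h₁, hly _ rfl] at hPy
  have hne : P ≠ [] := by
    rintro rfl
    simp at hPx
  have hx : P.head hne = x := by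
    rw [List.head?_eq_some_head hne] at hPx
    simpa using hPx
  have hy : P.getLast hne = y := by
    rw [List.getLast?_eq_some_getLast hne] at hPy
    simpa using hPy
  have hone : ∀ z : ι × V, P.count z = 1 := fun z => by
    rw [hPc z.1 z.2, h₁]
    exact List.count_eq_one_of_mem (hnd _) (hmem _ _)
  have hsupp : ((Walk.ofSupport P hne hP).copy hx hy).support = P := by
    rw [Walk.support_copy, Walk.support_ofSupport]
  refine ⟨(Walk.ofSupport P hne hP).copy hx hy, Walk.IsPath.isHamiltonian_of_mem ?_ ?_⟩
  · rw [Walk.isPath_def, hsupp]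
    exact List.nodup_iff_count_le_one.2 fun z => (hone z).le
  · intro z
    rw [hsupp]
    exact List.count_pos_iff.1 (by rw [hone]; exact Nat.one_pos)

/-- The number of visits to layer i must be [a ≤ i ≤ b] + g i + g (i+1). With the `g` below this is
n for odd i, and for i = 2j it is n - (E (j+1) - E j) + [a = i] + [b = i], so `r` is the increment
of `E` less the number of ends in the layer. That reduction pays for prescribing those ends in the
ordering. -/
theorem exists_isHamiltonian_lexProduct_pathGraph [Fintype V] [DecidableEq V] [Nonempty V] {k : ℕ}
    {H : SimpleGraph V} (hH : 2 ≤ H.maxLinearForest)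
    (hcard : Fintype.card V + 1 ≤ (k + 1) * H.maxLinearForest) {x y : Fin (2 * k + 1) × V}
    (hxy : x ≠ y) (hle : x.1 ≤ y.1) :
    ∃ p : ((pathGraph (2 * k + 1)).lexProduct H).Walk x y, p.IsHamiltonian := by
  have hle' : x.1.1 ≤ y.1.1 := hle
  have hyk := y.1.2
  have hlt := H.maxLinearForest_lt_card
  obtain ⟨E, hE0, hEk, hstep, hE⟩ :=
    exists_cumulative_edges hH hlt hcard hle' (by omega)
  set n := Fintype.card V
  set p := H.maxLinearForest
  let g : ℕ → ℕ := fun m => if m % 2 = 0 then E (m / 2) - (if x.1.1 < m then 1 else 0)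
    else n + (if y.1.1 < m then 1 else 0) - E ((m + 1) / 2)
  have hg_even : ∀ j, g (2 * j) = E j - if x.1.1 < 2 * j then 1 else 0 := by
    intro j
    simp [g]
  have hg_odd : ∀ j, g (2 * j + 1) = n + (if y.1.1 < 2 * j + 1 then 1 else 0) - E (j + 1) := by
    intro j
    have h₁ : (2 * j + 1) % 2 ≠ 0 := by omega
    have h₂ : (2 * j + 1 + 1) / 2 = j + 1 := by omega
    simp only [g, if_neg h₁, h₂]
  -- The four bounds on `E j` correspond to the cases here: `m` even or odd, below or above the
  -- direct route.
  have hpos : ∀ m, 1 ≤ m → m < 2 * k + 1 → (m ≤ x.1.1 ∨ y.1.1 < m) → 0 < g m := by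
    intro m h₁ h₂ h₃
    rcases Nat.even_or_odd' m with ⟨j, rfl | rfl⟩
    · have := hE j (by omega) (by omega)
      rw [hg_even]
      split_ifs <;> omega
    · have := hE (j + 1) (by omega) (by omega)
      rw [hg_odd]
      split_ifs <;> omega
  have hvis := hasVisits_pathGraph hle (g := g) (by simp [g, hE0])
    (by rw [hg_odd, hEk, if_pos (by omega)]; omega)
    (fun m h₁ h₂ => hpos m h₁ (by omega) (Or.inl h₂))
    (fun m h₁ h₂ => hpos m (by omega) h₂ (Or.inr h₁))
  refine hvis.exists_isHamiltonian hxy (r := fun i => if i.1 % 2 = 0 then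
    E (i.1 / 2 + 1) - E (i.1 / 2) - ((if i = x.1 then 1 else 0) + if i = y.1 then 1 else 0)
    else 0) ?_ ?_
  · intro i
    obtain ⟨i, hi⟩ := i
    simp only [Fin.le_def, Fin.ext_iff]
    rcases Nat.even_or_odd' i with ⟨j, rfl | rfl⟩
    · have h₁ := hstep j (by omega)
      have h₂ : 2 * j / 2 = j := by omega
      have h₃ : j = 0 ∨ (1 ≤ E j ∧ E j ≤ n ∧ (y.1.1 < 2 * j → 2 ≤ E j)) := by
        rcases Nat.eq_zero_or_pos j with h | h
        · exact Or.inl h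
        · have := hE j h (by omega)
          exact Or.inr ⟨this.1, this.2.1, this.2.2.1⟩
      have h₄ : E (j + 1) ≤ n ∨ (j = k ∧ E (j + 1) = n + 1) := by
        rcases (show j < k ∨ j = k by omega) with h | h
        · exact Or.inl (hE (j + 1) (by omega) (by omega)).2.1
        · exact Or.inr ⟨h, by rw [h, hEk]⟩
      rw [hg_even, hg_odd, if_pos (Nat.mul_mod_right 2 j), h₂]
      split_ifs at h₁ ⊢ <;> omega
    · have h₁ : (2 * j + 1) % 2 ≠ 0 := by omega
      have := hE (j + 1) (by omega) (by omega)
      rw [if_neg h₁, hg_odd, show 2 * j + 1 + 1 = 2 * (j + 1) by ring, hg_even]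
      split_ifs <;> omega
  · intro i
    have := hstep (i.1 / 2)  (by have := i.2; omega)
    by_cases h : i.1 % 2 = 0
    · right
      have h₂ : 2 * (i.1 / 2) = i.1 := by omega
      rw [h₂] at this
      simp only [Fin.ext_iff, if_pos h]
      omega
    · left
      simp [h]

end SimpleGraph

/-! ### The characterization -/

theorem theorem6 {V : Type*} [Fintype V] [DecidableEq V] [Nonempty V]
    (k : ℕ) (hk : 1 ≤ k) (H : SimpleGraph V) :
    ((SimpleGraph.pathGraph (2 * k + 1)).lexProduct H).IsHamiltonianConnected ↔
      2 ≤ H.maxLinearForest ∧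
        ⌈((Fintype.card V : ℚ) + 1) / (H.maxLinearForest : ℚ)⌉ ≤ (k : ℤ) + 1 := by
  have hceil : 2 ≤ H.maxLinearForest →
      (⌈((Fintype.card V : ℚ) + 1) / (H.maxLinearForest : ℚ)⌉ ≤ (k : ℤ) + 1 ↔
        Fintype.card V + 1 ≤ (k + 1) * H.maxLinearForest) := by
    intro h
    have hpos : (0 : ℚ) < H.maxLinearForest := by exact_mod_cast (by omega)
    rw [Int.ceil_le, div_le_iff₀ hpos]
    push_cast
    exact_mod_cast Iff.rfl
  constructor
  · intro h
    have := h.bounds hk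
    exact ⟨this.1, (hceil this.1).2 this.2⟩
  · rintro ⟨h₁, h₂⟩ x y hxy
    rw [hceil h₁] at h₂
    -- The construction assumes the start lies in the lower layer; otherwise the path is reversed.
    rcases le_total x.1 y.1 with hle | hle
    · exact SimpleGraph.exists_isHamiltonian_lexProduct_pathGraph h₁ h₂ hxy hle
    · obtain ⟨p, hp⟩ := SimpleGraph.exists_isHamiltonian_lexProduct_pathGraph h₁ h₂ hxy.symm hle
      exact ⟨p.reverse, hp.isPath.reverse.isHamiltonian_of_mem fun z => by
        rw [SimpleGraph.Walk.support_reverse, List.mem_reverse]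
        exact hp.mem_support z⟩
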